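/- Let $K$ be an infinite algebraic extension of a finite field of characteristic different from $2$. Let $D\in K[T]$ be a polynomial of even degree which is not a square in $K[T]$ and whose leading coefficient is a square in $K$. Then $D$ has a square root $\sqrt D$, unique up to sign, in the field $K((T^{-1}))$ of formal Laurent series in $T^{-1}$, and there exist infinitely many pairwise non-equivalent elements $\alpha\in K(T,\sqrt D)\setminus K(T)$, where $K(T,\sqrt D)\subset K((T^{-1}))$, such that all the partial quotients $a_n$ with $n\ge 1$ of the regular continued fraction expansion $\alpha=[a_0,a_1,a_2,\dots]$ have degree at most $1$ (hence exactly $1$). Here $a_n=\lfloor\alpha_n\rfloor$, where $\alpha_0=\alpha$, $\alpha_{n+1}=1/(\alpha_n-\lfloor\alpha_n\rfloor)$, and $\lfloor\sum_{i\le N}c_iT^i\rfloor=\sum_{0\le i\le N}c_iT^i$ denotes the polynomial part; two series $\alpha,\beta\in K((T^{-1}))$ are equivalent if $\alpha=\frac{A\beta+B}{C\beta+E}$ for some matrix $\begin{pmatrix}A&B\\C&E\end{pmatrix}\in\mathrm{GL}_2(K[T])$. -/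

import Mathlib

open Polynomial

noncomputable section

namespace PolyMcMullen

variable {K : Type*} [Field K]

/-- The indeterminate `T` of the field `L = K((T⁻¹))` of formal Laurent series in `T⁻¹`.
`L` is modelled by Mathlib's `LaurentSeries K`, whose uniformizer plays the role of `T⁻¹`:
the coefficient of `T ^ i` in `α` is `α.coeff (-i)`. -/
def laurentT (K : Type*) [Field K] : LaurentSeries K :=
  HahnSeries.single (-1 : ℤ) (1 : K)

/-- The inclusion `K[T] → K((T⁻¹))`. -/
def ofPoly : K[X] →ₐ[K] LaurentSeries K :=
  Polynomial.aeval (laurentT K)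

/-- The polynomial part `⌊α⌋ = ∑_{i ≥ 0} c_i T ^ i` of `α = ∑_{i ≤ N} c_i T ^ i`. -/
def polyPart (α : LaurentSeries K) : K[X] :=
  ∑ i ∈ Finset.range ((-α.order).toNat + 1), Polynomial.monomial i (α.coeff (-(i : ℤ)))

theorem coeff_polyPart (α : LaurentSeries K) (i : ℕ) :
    (polyPart α).coeff i = α.coeff (-(i : ℤ)) := by
  unfold polyPart
  rw [Polynomial.finsetSum_coeff]
  simp only [Polynomial.coeff_monomial, Finset.sum_ite_eq', Finset.mem_range]
  split_ifs with h
  · rfl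
  · symm
    apply HahnSeries.coeff_eq_zero_of_lt_order
    omega

/-- The complete quotients of the regular continued fraction expansion of `α`:
`α_0 = α` and `α_{n+1} = 1 / (α_n - ⌊α_n⌋)`. If the expansion is finite, all the terms
after the end of the expansion are `0`. -/
def completeQuotient (α : LaurentSeries K) : ℕ → LaurentSeries K
  | 0 => α
  | n + 1 => (completeQuotient α n - ofPoly (polyPart (completeQuotient α n)))⁻¹

/-- The partial quotients `a_n = ⌊α_n⌋` of `α = [a_0, a_1, …]`. -/
def partialQuotient (α : LaurentSeries K) (n : ℕ) : K[X] :=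
  polyPart (completeQuotient α n)

/-- `K(α) = sup_{n ≥ 1} deg a_n ∈ ℕ ∪ {∞}`. (The terms `0` that pad a finite expansion
have `natDegree` zero and do not change the supremum.) -/
def maxDegree (α : LaurentSeries K) : ℕ∞ :=
  ⨆ n : ℕ, ((partialQuotient α (n + 1)).natDegree : ℕ∞)

/-- `α ∼ β`: there is `M ∈ GL₂(K[T])` with `α = M β`, where `M` acts by Möbius
transformations. -/
def Equivalent (α β : LaurentSeries K) : Prop :=
  ∃ M : Matrix.GeneralLinearGroup (Fin 2) K[X],
    ofPoly (M.1 1 0) * β + ofPoly (M.1 1 1) ≠ 0 ∧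
    α = (ofPoly (M.1 0 0) * β + ofPoly (M.1 0 1)) /
        (ofPoly (M.1 1 0) * β + ofPoly (M.1 1 1))

/-- The set of the polynomials of even degree which are not squares in `K[T]` and whose
leading coefficient is a square in `K`. (They are non-constant, since a constant with these
properties, or the zero polynomial, would be a square.) -/
def admissible (K : Type*) [Field K] : Set K[X] :=
  {D | Even D.natDegree ∧ ¬ IsSquare D ∧ IsSquare D.leadingCoeff}

/-- For a square root `s` of `D` in `K((T⁻¹))`, the quadratic irrationalities of `K(T, √D)`,
i.e. the elements of `K(T, s)` that are not in `K(T)`. -/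
def quadraticIrrationalities (s : LaurentSeries K) : Set (LaurentSeries K) :=
  {α | α ∈ IntermediateField.adjoin K {laurentT K, s} ∧
    α ∉ IntermediateField.adjoin K {laurentT K}}

/-- The polynomial analogue of McMullen's conjecture over `K` with constant `m`: for every
admissible `D`, the square root of `D` exists in `K((T⁻¹))` and (for each of its two choices,
which generate the same field) there are infinitely many pairwise non-equivalent quadratic
irrationalities `α` in `K(T, √D)` with `K(α) ≤ m`. -/
def McMullenConjecture (K : Type*) [Field K] (m : ℕ) : Prop :=
  ∀ D ∈ admissible K,
    (∃ s : LaurentSeries K, s ^ 2 = ofPoly D) ∧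
    ∀ s : LaurentSeries K, s ^ 2 = ofPoly D →
      ∃ S : Set (LaurentSeries K),
        S.Infinite ∧
        S.Pairwise (fun α β => ¬ Equivalent α β) ∧
        ∀ α ∈ S, α ∈ quadraticIrrationalities s ∧ maxDegree α ≤ m

end PolyMcMullen

end

/-! Let `x ^ 2 - D y ^ 2 = 1` with `y ≠ 0`, and let `ε = x + y √D` have degree `n + 1 > deg y`.
Choose `n` points `θ` at which `D(θ) = σ ^ 2` is a nonzero square and `y(θ) ≠ 0`. Put `h = ∏ (T -
θ)`, let `e` interpolate the values `x(θ) + y(θ) σ`, and take `α = (ε - e) / h`.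

At the chosen points `e` and `2x - e` take the values of `ε` and of its conjugate, so `h ∣ (2x - e)
e - 1`. Hence the lattice `K[T] + K[T] α` is stable under the unit `ε`. An approximation of `α` that
is too good can therefore be multiplied by `ε` until its denominator has degree at most `n`. There
it would give polynomials `v`, `w` of small degrees with `v = w ε` at all the points, and generic
points exclude this (`exists_points`, `NormalFraction.badlyApproximable`). So all partial quotients
after the first have degree `1`.

The multipliers of the lattice that are of the form `z √D` with `z` a polynomial are those with `y ∣
z`, so the degree of `y` is an invariant of the equivalence class. Powers of a unit make it
unbounded, which gives infinitely many classes.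

Two arithmetic inputs remain. A nontrivial Pell solution exists because `D` is defined over a finite
subfield, where Dirichlet approximation and the pigeonhole principle apply (`exists_pell`).
Infinitely many `θ` with `D(θ)` a square are supplied by a Stepanov argument over large finite
subfields (`infinite_isSquare_eval`). -/

namespace PolyMcMullen

/-! ### Orders and polynomial parts of Laurent series. -/

section Laurent

variable {K : Type*} [Field K]

theorem ofPoly_monomial (n : ℕ) (a : K) :
    ofPoly (monomial n a) = HahnSeries.single (-(n : ℤ)) a := by
  have h : (laurentT K) ^ n = HahnSeries.single (-(n : ℤ)) (1 : K) := by
    rw [laurentT, HahnSeries.single_pow]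
    simp
  rw [ofPoly, aeval_monomial, h, HahnSeries.algebraMap_apply',
    PowerSeries.algebraMap_apply, Algebra.algebraMap_self, RingHom.id_apply,
    HahnSeries.ofPowerSeries_C, HahnSeries.C_apply, HahnSeries.single_mul_single]
  simp

theorem coeff_ofPoly_neg (p : K[X]) (i : ℕ) : (ofPoly p).coeff (-(i : ℤ)) = p.coeff i := by
  induction p using Polynomial.induction_on' with
  | add p q hp hq => simp [hp, hq]
  | monomial n a =>
    rw [ofPoly_monomial, coeff_monomial, HahnSeries.coeff_single]
    simp [eq_comm]

theorem coeff_ofPoly_of_pos (p : K[X]) {j : ℤ} (hj : 0 < j) : (ofPoly p).coeff j = 0 := by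
  induction p using Polynomial.induction_on' with
  | add p q hp hq => simp [hp, hq]
  | monomial n a =>
    rw [ofPoly_monomial, HahnSeries.coeff_single, if_neg (by omega)]

theorem ofPoly_injective : Function.Injective (ofPoly : K[X] → LaurentSeries K) := by
  intro p q h
  ext i
  rw [← coeff_ofPoly_neg, h, coeff_ofPoly_neg]

theorem ofPoly_ne_zero {p : K[X]} (hp : p ≠ 0) : ofPoly p ≠ 0 := by
  rw [← map_zero (ofPoly (K := K))]
  exact fun h => hp (ofPoly_injective h)

theorem order_eq_of_coeff {z : LaurentSeries K} {n : ℤ} (h0 : z.coeff n ≠ 0)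
    (h : ∀ j < n, z.coeff j = 0) : z.order = n := by
  refine le_antisymm (HahnSeries.order_le_of_coeff_ne_zero h0) ?_
  by_contra hlt
  have hz : z ≠ 0 := by
    rintro rfl
    exact h0 rfl
  exact hz (HahnSeries.coeff_order_eq_zero.1 (h _ (not_le.1 hlt)))

theorem order_ofPoly {p : K[X]} (hp : p ≠ 0) : (ofPoly p).order = -(p.natDegree : ℤ) := by
  apply order_eq_of_coeff
  · rw [coeff_ofPoly_neg]
    simpa using hp
  · intro j hj
    obtain ⟨i, rfl⟩ : ∃ i : ℕ, j = -(i : ℤ) := ⟨(-j).toNat, by omega⟩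
    rw [coeff_ofPoly_neg]
    exact coeff_eq_zero_of_natDegree_lt (by omega)

theorem le_order_of_coeff {z : LaurentSeries K} (hz : z ≠ 0) {n : ℤ}
    (h : ∀ j < n, z.coeff j = 0) : n ≤ z.order :=
  (HahnSeries.le_order_iff_forall hz).2 h

theorem le_order_add {a b : LaurentSeries K} {n : ℤ} (hab : a + b ≠ 0)
    (ha : a ≠ 0 → n ≤ a.order) (hb : b ≠ 0 → n ≤ b.order) : n ≤ (a + b).order := by
  by_cases h1 : a = 0
  · subst h1
    simp only [zero_add] at hab ⊢
    exact hb hab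
  by_cases h2 : b = 0
  · subst h2
    simp only [add_zero] at hab ⊢
    exact ha hab
  exact (le_min (ha h1) (hb h2)).trans (HahnSeries.min_order_le_order_add hab)

theorem order_add_eq_right {a b : LaurentSeries K} (hb : b ≠ 0)
    (h : a ≠ 0 → b.order < a.order) : a + b ≠ 0 ∧ (a + b).order = b.order := by
  by_cases h1 : a = 0
  · simp [h1, hb]
  have hlt := h h1
  have hc : (a + b).coeff b.order ≠ 0 := by
    rw [HahnSeries.coeff_add, HahnSeries.coeff_eq_zero_of_lt_order hlt, zero_add]
    exact fun h => hb (HahnSeries.coeff_order_eq_zero.1 h)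
  refine ⟨fun h0 => hc (by simp [h0]), order_eq_of_coeff hc fun j hj => ?_⟩
  rw [HahnSeries.coeff_add, HahnSeries.coeff_eq_zero_of_lt_order hj,
    HahnSeries.coeff_eq_zero_of_lt_order (hj.trans hlt), zero_add]

theorem order_inv' {z : LaurentSeries K} (hz : z ≠ 0) : (z⁻¹).order = -z.order := by
  have := HahnSeries.order_mul hz (inv_ne_zero hz)
  rw [mul_inv_cancel₀ hz, HahnSeries.order_one] at this
  omega

theorem coeff_sub_polyPart_nonpos (z : LaurentSeries K) {j : ℤ} (hj : j ≤ 0) :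
    (z - ofPoly (polyPart z)).coeff j = 0 := by
  obtain ⟨i, rfl⟩ : ∃ i : ℕ, j = -(i : ℤ) := ⟨(-j).toNat, by omega⟩
  rw [HahnSeries.coeff_sub, coeff_ofPoly_neg, coeff_polyPart, sub_self]

theorem coeff_sub_polyPart_pos (z : LaurentSeries K) {j : ℤ} (hj : 0 < j) :
    (z - ofPoly (polyPart z)).coeff j = z.coeff j := by
  rw [HahnSeries.coeff_sub, coeff_ofPoly_of_pos _ hj, sub_zero]

theorem one_le_order_sub_polyPart {z : LaurentSeries K} (hz : z - ofPoly (polyPart z) ≠ 0) :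
    1 ≤ (z - ofPoly (polyPart z)).order :=
  le_order_of_coeff hz fun _ hj => coeff_sub_polyPart_nonpos z (by omega)

theorem natDegree_polyPart_le {z : LaurentSeries K} {n : ℕ} (h : -(n : ℤ) ≤ z.order) :
    (polyPart z).natDegree ≤ n := by
  rw [natDegree_le_iff_coeff_eq_zero]
  intro i hi
  rw [coeff_polyPart]
  exact HahnSeries.coeff_eq_zero_of_lt_order (by omega)

/-- A polynomial that is the sum of series of positive order vanishes. -/
theorem eq_zero_of_order_pos {p : K[X]} (h : p ≠ 0 → 0 < (ofPoly p).order) : p = 0 := by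
  by_contra hp
  have := h hp
  rw [order_ofPoly hp] at this
  omega

end Laurent

/-! ### Badly approximable series have linear partial quotients. -/

section BadlyApproximable

variable {K : Type*} [Field K]

/-- The series `α` satisfies `|q α - p| ≥ 1 / (|T| |q|)` for all polynomials `p` and `q ≠ 0`. -/
def BadlyApproximable (α : LaurentSeries K) : Prop :=
  ∀ p q : K[X], q ≠ 0 → ofPoly q * α - ofPoly p ≠ 0 ∧
    (ofPoly q * α - ofPoly p).order ≤ q.natDegree + 1

theorem BadlyApproximable.order_fract {α : LaurentSeries K} (h : BadlyApproximable α) :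
    α - ofPoly (polyPart α) ≠ 0 ∧ (α - ofPoly (polyPart α)).order = 1 := by
  obtain ⟨h1, h2⟩ := h (polyPart α) 1 one_ne_zero
  simp only [map_one, one_mul, natDegree_one] at h1 h2
  exact ⟨h1, le_antisymm (by simpa using h2) (one_le_order_sub_polyPart h1)⟩

/-- With `β = 1 / (α - a)` of degree `1`, one has `q β - p = -β (p α - (q + p a))`: approximating
`β` by `p / q` amounts to approximating `α` with denominator `p`. -/
theorem BadlyApproximable.inv_fract {α : LaurentSeries K} (h : BadlyApproximable α) :
    BadlyApproximable (α - ofPoly (polyPart α))⁻¹ := by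
  obtain ⟨h0, h1⟩ := h.order_fract
  set a := polyPart α
  set b := (α - ofPoly a)⁻¹ with hb
  have hb0 : b ≠ 0 := inv_ne_zero h0
  have hb1 : b.order = -1 := by rw [hb, order_inv' h0, h1]
  intro p q hq
  by_cases hp : p = 0
  · subst hp
    have : ofPoly q * b ≠ 0 := mul_ne_zero (ofPoly_ne_zero hq) hb0
    simp only [map_zero, sub_zero]
    refine ⟨this, ?_⟩
    rw [HahnSeries.order_mul (ofPoly_ne_zero hq) hb0, order_ofPoly hq, hb1]
    omega
  obtain ⟨h2, h3⟩ := h (q + p * a) p hp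
  have key : ofPoly q * b - ofPoly p = -(b * (ofPoly p * α - ofPoly (q + p * a))) := by
    have : b * (α - ofPoly a) = 1 := inv_mul_cancel₀ h0
    simp only [map_add, map_mul]
    linear_combination (ofPoly p) * this
  have hne : ofPoly q * b - ofPoly p ≠ 0 := by
    rw [key]
    exact neg_ne_zero.2 (mul_ne_zero hb0 h2)
  refine ⟨hne, ?_⟩
  have ho : (ofPoly q * b - ofPoly p).order =
      -1 + (ofPoly p * α - ofPoly (q + p * a)).order := by
    rw [key, HahnSeries.order_neg, HahnSeries.order_mul hb0 h2, hb1]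
  by_contra hlt
  have hqb : (ofPoly q * b).order = -q.natDegree - 1 := by
    rw [HahnSeries.order_mul (ofPoly_ne_zero hq) hb0, order_ofPoly hq, hb1]
    ring
  -- If `q β - p` were too small, `p` and `q β` would have equal degree, so `deg p = deg q + 1`, and
  -- the bound for `α` with denominator `p` gives the contradiction.
  have := (order_add_eq_right (a := -(ofPoly q * b - ofPoly p)) (b := ofPoly q * b)
    (mul_ne_zero (ofPoly_ne_zero hq) hb0) (fun _ => by
      rw [HahnSeries.order_neg]
      omega)).2
  rw [show -(ofPoly q * b - ofPoly p) + ofPoly q * b = ofPoly p by ring, order_ofPoly hp,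
    hqb] at this
  omega

theorem BadlyApproximable.completeQuotient {α : LaurentSeries K} (h : BadlyApproximable α)
    (n : ℕ) : BadlyApproximable (completeQuotient α n) := by
  induction n with
  | zero => exact h
  | succ n ih => exact ih.inv_fract

theorem BadlyApproximable.maxDegree_le {α : LaurentSeries K} (h : BadlyApproximable α) :
    maxDegree α ≤ 1 := by
  refine iSup_le fun n => ?_
  obtain ⟨h0, h1⟩ := (h.completeQuotient n).order_fract
  have : (partialQuotient α (n + 1)).natDegree ≤ 1 := by
    apply natDegree_polyPart_le
    change _ ≤ ((PolyMcMullen.completeQuotient α n -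
      ofPoly (polyPart (PolyMcMullen.completeQuotient α n)))⁻¹).order
    rw [order_inv' h0, h1]
    norm_num
  exact_mod_cast this

theorem BadlyApproximable.notMem_adjoin {α : LaurentSeries K} (h : BadlyApproximable α) :
    α ∉ IntermediateField.adjoin K {laurentT K} := by
  intro hα
  obtain ⟨p, q, hpq⟩ := (IntermediateField.mem_adjoin_simple_iff K α).1 hα
  change α = ofPoly p / ofPoly q at hpq
  -- Division by zero makes `α = 0` here, which is excluded by the approximation `0 / 1`.
  by_cases hq : q = 0
  · apply (h 0 1 one_ne_zero).1
    simp [hpq, hq]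
  · apply (h p q hq).1
    rw [hpq, mul_div_cancel₀ _ (ofPoly_ne_zero hq), sub_self]

end BadlyApproximable

/-! ### Existence of the square root of `D`. -/

section Sqrt

variable {K : Type*} [Field K]

/-- Hensel's lemma lifts the root `c` of `Y ^ 2 - f` modulo the uniformizer; it is simple because `2
c ≠ 0`. -/
theorem _root_.PowerSeries.exists_sq_eq (h2 : (2 : K) ≠ 0) (f : PowerSeries K) {c : K} (hc : c ≠ 0)
    (hf : PowerSeries.constantCoeff f = c ^ 2) : ∃ g : PowerSeries K, g ^ 2 = f := by
  have hH : HenselianRing (PowerSeries K) (Ideal.span {PowerSeries.X}) := inferInstance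
  have hc' : PowerSeries.constantCoeff (PowerSeries.C c : PowerSeries K) = c := by simp
  obtain ⟨g, hg, -⟩ := hH.is_henselian (X ^ 2 - C f) (monic_X_pow_sub_C f two_ne_zero)
    (PowerSeries.C c) (by
      rw [Ideal.mem_span_singleton, PowerSeries.X_dvd_iff]
      simp [hf]) (by
      apply IsUnit.map
      rw [PowerSeries.isUnit_iff_constantCoeff]
      simp [hc, one_add_one_eq_two, map_ofNat, h2])
  refine ⟨g, ?_⟩
  simpa [IsRoot, sub_eq_zero] using hg

/-- `D` is `T ^ (2 d)` times its reverse evaluated at `T⁻¹`, a power series whose constant term is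
the square leading coefficient. -/
theorem exists_sq_eq_ofPoly (h2 : (2 : K) ≠ 0) {D : K[X]} (hD : D ∈ admissible K) :
    ∃ s : LaurentSeries K, s ^ 2 = ofPoly D := by
  obtain ⟨⟨d, hd⟩, hns, ⟨c, hc⟩⟩ := hD
  have hD0 : D ≠ 0 := by
    rintro rfl
    exact hns ⟨0, by simp⟩
  have hc0 : c ≠ 0 := by
    rintro rfl
    simp [hD0] at hc
  obtain ⟨g, hg⟩ := PowerSeries.exists_sq_eq h2 (D.reverse : PowerSeries K) hc0
    (by simp [coeff_zero_reverse, hc, sq])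
  refine ⟨HahnSeries.single (-(d : ℤ)) 1 * HahnSeries.ofPowerSeries ℤ K g, ?_⟩
  rw [mul_pow, HahnSeries.single_pow, ← map_pow (HahnSeries.ofPowerSeries ℤ K), hg]
  ext j
  rw [one_pow, ← zero_add j, show (0 : ℤ) + j = (j + 2 * d) + (2 : ℕ) • (-(d : ℤ)) by simp,
    HahnSeries.coeff_single_mul_add, one_mul]
  have h3 : (j + 2 * d) + (2 : ℕ) • (-(d : ℤ)) = j := by simp
  rw [h3]
  by_cases hj : 0 < j
  · rw [coeff_ofPoly_of_pos _ hj]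
    obtain ⟨i, hi⟩ : ∃ i : ℕ, j + 2 * d = i := ⟨(j + 2 * d).toNat, by omega⟩
    rw [hi]
    erw [LaurentSeries.coeff_coe_powerSeries]
    rw [Polynomial.coeff_coe]
    apply coeff_eq_zero_of_natDegree_lt
    have := reverse_natDegree_le D
    omega
  · obtain ⟨i, rfl⟩ : ∃ i : ℕ, j = -(i : ℤ) := ⟨(-j).toNat, by omega⟩
    rw [coeff_ofPoly_neg]
    by_cases hi : i ≤ D.natDegree
    · obtain ⟨k, hk⟩ : ∃ k : ℕ, k + i = D.natDegree := ⟨D.natDegree - i, by omega⟩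
      rw [show (-(i : ℤ) + 2 * d) = (k : ℕ) by omega]
      erw [LaurentSeries.coeff_coe_powerSeries]
      rw [Polynomial.coeff_coe, coeff_reverse, revAt_le (by omega)]
      congr 1
      omega
    · rw [coeff_eq_zero_of_natDegree_lt (by omega)]
      erw [PowerSeries.coeff_coe]
      rw [if_pos (by omega)]

end Sqrt

/-! ### Bad approximability from a unit of the lattice. -/

section Quadratic

variable {K : Type*} [Field K]

theorem isSquare_of_mul_sq_eq_sq {D a b : K[X]} (hb : b ≠ 0) (h : D * b ^ 2 = a ^ 2) :
    IsSquare D := by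
  obtain ⟨c, rfl⟩ : b ∣ a := by
    rw [← IsIntegrallyClosed.pow_dvd_pow_iff (two_ne_zero)]
    exact ⟨D, by rw [← h, mul_comm]⟩
  refine ⟨c, mul_right_cancel₀ (pow_ne_zero 2 hb) ?_⟩
  rw [h]
  ring

theorem eq_zero_of_add_mul_sqrt_eq_zero {D : K[X]} (hD : ¬ IsSquare D) {s : LaurentSeries K}
    (hs : s ^ 2 = ofPoly D) {a b : K[X]} (h : ofPoly a + ofPoly b * s = 0) : a = 0 ∧ b = 0 := by
  have hb : b = 0 := by
    by_contra hb
    refine hD (isSquare_of_mul_sq_eq_sq (a := a) hb (ofPoly_injective ?_))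
    simp only [map_mul, map_pow]
    rw [← hs]
    linear_combination (-ofPoly a + ofPoly b * s) * h
  subst hb
  refine ⟨ofPoly_injective ?_, rfl⟩
  simpa using h

/-- Linear combinations of small degree of `1` and `e` that are divisible by `h` are trivial:
this says that all the partial quotients of `e / h` are linear. -/
def NormalFraction (e h : K[X]) : Prop :=
  ∀ v w : K[X], v ≠ 0 → w ≠ 0 → h ∣ w * e - v → h.natDegree ≤ v.natDegree + w.natDegree + 1

/-- Multiplication by `ε` maps the lattice `K[T] + K[T] α` to itself, so a counterexample with large
denominator yields one with smaller denominator. For denominators of degree below `n = deg h`, the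
hypothesis on `e / h` gives the bound. -/
theorem NormalFraction.badlyApproximable {D : K[X]} (hD : ¬ IsSquare D) {s : LaurentSeries K}
    (hs : s ^ 2 = ofPoly D) {x y e h : K[X]} (hxy : x ^ 2 - D * y ^ 2 = 1) (hy : y ≠ 0)
    (h0 : h ≠ 0) (hR : (ofPoly x + ofPoly y * s).order = -(h.natDegree + 1 : ℤ))
    (hdvd : h ∣ (2 * x - e) * e - 1) (hN : NormalFraction e h) :
    BadlyApproximable ((ofPoly x + ofPoly y * s - ofPoly e) / ofPoly h) := by
  set ε := ofPoly x + ofPoly y * s with hε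
  set ε' := ofPoly x - ofPoly y * s with hε'
  set α := (ε - ofPoly e) / ofPoly h with hα
  set n := h.natDegree with hn
  have hh0 := ofPoly_ne_zero h0
  have hhα : ofPoly h * α = ε - ofPoly e := mul_div_cancel₀ _ hh0
  have hεε : ε * ε' = 1 := by
    rw [← map_one (ofPoly (K := K)), ← hxy]
    simp only [map_sub, map_mul, map_pow, hε, hε']
    linear_combination - (ofPoly y) ^ 2 * hs
  have hε0 : ε ≠ 0 := left_ne_zero_of_mul_eq_one hεε
  have hε'0 : ε' ≠ 0 := right_ne_zero_of_mul_eq_one hεε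
  have hR' : ε'.order = n + 1 := by
    have := HahnSeries.order_mul hε0 hε'0
    rw [hεε, HahnSeries.order_one, hR] at this
    omega
  obtain ⟨b, hb⟩ := hdvd
  have hb' : ofPoly h * ofPoly b = (ε + ε' - ofPoly e) * ofPoly e - 1 := by
    rw [← map_mul, ← hb]
    simp only [map_sub, map_mul, map_one, map_ofNat, hε, hε']
    ring
  have hεα : ε * α = (ε + ε' - ofPoly e) * α + ofPoly b := by
    apply mul_left_cancel₀ hh0
    linear_combination (-ε' + ofPoly e) * hhα - hb' - hεε
  have hne : ∀ p q : K[X], q ≠ 0 → ofPoly q * α - ofPoly p ≠ 0 := by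
    intro p q hq hL
    have : ofPoly (q * x - q * e - p * h) + ofPoly (q * y) * s = 0 := by
      simp only [map_sub, map_mul]
      linear_combination ofPoly h * hL - ofPoly q * hhα + ofPoly q * hε
    exact mul_ne_zero hq hy (eq_zero_of_add_mul_sqrt_eq_zero hD hs this).2
  suffices H : ∀ m : ℕ, ∀ p q : K[X], q ≠ 0 → q.natDegree = m →
      (ofPoly q * α - ofPoly p).order ≤ m + 1 from
    fun p q hq => ⟨hne p q hq, H _ p q hq rfl⟩
  intro m
  induction m using Nat.strong_induction_on with
  | _ m ih =>
  intro p q hq hm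
  by_contra! hlt
  set L := ofPoly q * α - ofPoly p with hL
  have hL0 : L ≠ 0 := hne p q hq
  have hq0 := ofPoly_ne_zero hq
  set w := q * (2 * x - e) - p * h with hw
  -- `w` is also the denominator of `ε L`. The term `q ε'` has degree `deg q - n - 1`, so `w` is
  -- small whenever `L` is.
  have hwL : ofPoly h * L + ofPoly q * ε' = ofPoly w := by
    simp only [hw, map_sub, map_mul, map_ofNat]
    linear_combination (ofPoly h) * hL + ofPoly q * hhα + ofPoly q * hε + ofPoly q * hε'
  have ho1 : (ofPoly h * L).order = -n + L.order := by
    rw [HahnSeries.order_mul hh0 hL0, order_ofPoly h0]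
  have ho2 : (ofPoly q * ε').order = -m + (n + 1) := by
    rw [HahnSeries.order_mul hq0 hε'0, order_ofPoly hq, hR', hm]
  rcases lt_trichotomy m n with hmn | hmn | hmn
  -- Small denominators: `h` divides `w e - q`, while both terms of `w` have degree at most `n - m -
  -- 2`.
  · have hw0 : w ≠ 0 := by
      intro h1
      have : h ∣ q := by
        have h2 : q * (2 * x - e) = p * h := by
          rw [← sub_eq_zero]
          exact h1
        refine ⟨p * e - q * b, ?_⟩
        linear_combination e * h2 - q * hb
      have := natDegree_le_of_dvd this hq
      omega
    have h1 := hN q w hq hw0 ⟨q * b - p * e, by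
      rw [hw]
      linear_combination q * hb⟩
    have h2 : -((n : ℤ) - m - 2) ≤ (ofPoly w).order := by
      rw [← hwL]
      refine le_order_add (by rw [hwL]; exact ofPoly_ne_zero hw0) (fun _ => ?_) (fun _ => ?_)
      · omega
      · omega
    rw [order_ofPoly hw0] at h2
    omega
  -- Both terms of `w` have positive order, so `w = 0`; but `h L` and `q ε'` have different orders.
  · have hw0 : w = 0 := by
      apply eq_zero_of_order_pos
      intro hw0
      have : 1 ≤ (ofPoly w).order := by
        rw [← hwL]
        refine le_order_add (by rw [hwL]; exact ofPoly_ne_zero hw0) (fun _ => ?_) (fun _ => ?_)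
        · omega
        · omega
      omega
    rw [hw0, map_zero, add_eq_zero_iff_eq_neg] at hwL
    rw [hwL, HahnSeries.order_neg] at ho1
    omega
  -- Large denominators: `q ε'` dominates, so `deg w = m - n - 1`, and `ε L` is a counterexample
  -- with denominator `w`.
  · obtain ⟨h1, h2⟩ := order_add_eq_right (a := ofPoly h * L) (b := ofPoly q * ε')
      (mul_ne_zero hq0 hε'0) (fun _ => by omega)
    rw [hwL] at h1 h2
    have hw0 : w ≠ 0 := by
      rintro h3
      exact h1 (by rw [h3, map_zero])
    rw [order_ofPoly hw0] at h2
    have h3 := ih w.natDegree (by omega) (p * e - q * b) w hw0 rfl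
    have h4 : ofPoly w * α - ofPoly (p * e - q * b) = ε * L := by
      simp only [hw, map_sub, map_mul, map_ofNat]
      linear_combination -(ofPoly q) * hεα - ofPoly p * hhα - ε * hL -
        ofPoly q * α * hε - ofPoly q * α * hε'
    rw [h4, HahnSeries.order_mul hε0 hL0, hR] at h3
    omega

end Quadratic

/-! ### The conductor as an invariant of equivalence. -/

section Equivalence

variable {K : Type*} [Field K]

/-- `z` belongs to the multiplier ring of the lattice `K[T] + K[T] α`. -/
def IsMultiplier (α z : LaurentSeries K) : Prop :=
  (∃ a b : K[X], z = ofPoly a + ofPoly b * α) ∧ ∃ a b : K[X], z * α = ofPoly a + ofPoly b * α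

theorem Equivalent.symm {α β : LaurentSeries K} (h : Equivalent α β) : Equivalent β α := by
  obtain ⟨M, h0, hα⟩ := h
  have hdet : IsUnit M.1.det := M.det.isUnit
  have hd : ofPoly (M.1 0 0) * ofPoly (M.1 1 1) - ofPoly (M.1 0 1) * ofPoly (M.1 1 0) ≠ 0 := by
    rw [← map_mul, ← map_mul, ← map_sub, ← Matrix.det_fin_two]
    exact ofPoly_ne_zero hdet.ne_zero
  have hu : IsUnit (M.1.adjugate).det := by
    rw [Matrix.det_adjugate]
    exact hdet.pow _
  refine ⟨Matrix.GeneralLinearGroup.mk'' M.1.adjugate hu, ?_⟩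
  have hα' : α * (ofPoly (M.1 1 0) * β + ofPoly (M.1 1 1)) =
    ofPoly (M.1 0 0) * β + ofPoly (M.1 0 1) := by rw [hα, div_mul_cancel₀ _ h0]
  change ofPoly (M.1.adjugate 1 0) * α + ofPoly (M.1.adjugate 1 1) ≠ 0 ∧
    β = (ofPoly (M.1.adjugate 0 0) * α + ofPoly (M.1.adjugate 0 1)) /
      (ofPoly (M.1.adjugate 1 0) * α + ofPoly (M.1.adjugate 1 1))
  rw [Matrix.adjugate_fin_two]
  simp only [Matrix.of_apply, Matrix.cons_val', Matrix.cons_val_zero, Matrix.cons_val_one,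
    Matrix.cons_val_fin_one, map_neg]
  have h1 : -ofPoly (M.1 1 0) * α + ofPoly (M.1 0 0) ≠ 0 := by
    intro h1
    apply hd
    linear_combination (ofPoly (M.1 1 0) * β + ofPoly (M.1 1 1)) * h1 + ofPoly (M.1 1 0) * hα'
  refine ⟨h1, ?_⟩
  rw [eq_div_iff h1]
  linear_combination -hα'

/-- Equivalent series span homothetic lattices: `K[T] + K[T] β = (C β + E) (K[T] + K[T] α)`, and
scaling does not change the multiplier ring. -/
theorem IsMultiplier.of_equivalent {α β z : LaurentSeries K} (h : Equivalent α β)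
    (hz : IsMultiplier β z) : IsMultiplier α z := by
  obtain ⟨M, h0, hα⟩ := h
  obtain ⟨⟨a, b, hab⟩, c, d, hcd⟩ := hz
  obtain ⟨u, hu⟩ := M.det.isUnit.exists_right_inv
  change M.1.det * u = 1 at hu
  rw [Matrix.det_fin_two] at hu
  have hu' := congrArg ofPoly hu
  simp only [map_sub, map_mul, map_one] at hu'
  have hα' : α * (ofPoly (M.1 1 0) * β + ofPoly (M.1 1 1)) =
    ofPoly (M.1 0 0) * β + ofPoly (M.1 0 1) := by rw [hα, div_mul_cancel₀ _ h0]
  generalize M.1 0 0 = A at *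
  generalize M.1 0 1 = B at *
  generalize M.1 1 0 = C at *
  generalize M.1 1 1 = E at *
  have key : ∀ X Y : K[X], ofPoly X + ofPoly Y * β =
      (ofPoly (u * (X * A - Y * B)) + ofPoly (u * (Y * E - X * C)) * α) *
        (ofPoly C * β + ofPoly E) := by
    intro X Y
    simp only [map_sub, map_mul]
    linear_combination -(ofPoly X + ofPoly Y * β) * hu' -
      ofPoly u * (ofPoly Y * ofPoly E - ofPoly X * ofPoly C) * hα'
  refine ⟨⟨_, _, mul_right_cancel₀ h0 ((?_ : _ = _).trans (key (C * c + E * a) (C * d + E * b)))⟩,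
    _, _, mul_right_cancel₀ h0 ((?_ : _ = _).trans (key (A * c + B * a) (A * d + B * b)))⟩
  · simp only [map_add, map_mul]
    linear_combination ofPoly C * hcd + ofPoly E * hab
  · simp only [map_add, map_mul]
    linear_combination ofPoly A * hcd + ofPoly B * hab + z * hα'

/-- `α = (g + y √D) / h` is a root of the primitive form `(h, -2 g, -b)` of discriminant
`4 D y²`. -/
def HasConductor (s α : LaurentSeries K) (y : K[X]) : Prop :=
  ∃ g h b : K[X], h ≠ 0 ∧ IsCoprime h g ∧ ofPoly h * α = ofPoly g + ofPoly y * s ∧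
    ofPoly (h * b) + ofPoly g ^ 2 = ofPoly y ^ 2 * s ^ 2

theorem HasConductor.isMultiplier {s α : LaurentSeries K} {y : K[X]} (h : HasConductor s α y) :
    IsMultiplier α (ofPoly y * s) := by
  obtain ⟨g, h, b, h0, -, hα, hb⟩ := h
  refine ⟨⟨-g, h, ?_⟩, b, g, ?_⟩
  · rw [map_neg]
    linear_combination -hα
  · apply mul_left_cancel₀ (ofPoly_ne_zero h0)
    rw [map_mul] at hb
    linear_combination (ofPoly y * s - ofPoly g) * hα - hb

/-- Comparing coefficients of `1` and `√D` in `z √D = A + B α` gives `h A + B g = 0` and `h z = B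
y`. Coprimality forces `h ∣ B`, whence `y ∣ z`. -/
theorem HasConductor.dvd {D : K[X]} (hD : ¬ IsSquare D) {s : LaurentSeries K}
    (hs : s ^ 2 = ofPoly D) {α : LaurentSeries K} {y z : K[X]} (h : HasConductor s α y)
    (hz : IsMultiplier α (ofPoly z * s)) : y ∣ z := by
  obtain ⟨g, h, b, h0, hco, hα, hb⟩ := h
  obtain ⟨⟨A, B, hAB⟩, -⟩ := hz
  have : ofPoly (h * A + B * g) + ofPoly (B * y - h * z) * s = 0 := by
    simp only [map_add, map_sub, map_mul]
    linear_combination -ofPoly h * hAB - ofPoly B * hα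
  obtain ⟨h1, h2⟩ := eq_zero_of_add_mul_sqrt_eq_zero hD hs this
  obtain ⟨c, rfl⟩ : h ∣ B := hco.dvd_of_dvd_mul_right ⟨-A, by linear_combination h1⟩
  refine ⟨c, mul_left_cancel₀ h0 ?_⟩
  linear_combination -h2

theorem HasConductor.natDegree_eq {D : K[X]} (hD : ¬ IsSquare D) {s : LaurentSeries K}
    (hs : s ^ 2 = ofPoly D) {α β : LaurentSeries K} {y z : K[X]} (hα : HasConductor s α y)
    (hβ : HasConductor s β z) (h : Equivalent α β) : y.natDegree = z.natDegree := by
  have h1 : y ∣ z := hα.dvd hD hs (hβ.isMultiplier.of_equivalent h)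
  have h2 : z ∣ y := hβ.dvd hD hs (hα.isMultiplier.of_equivalent h.symm)
  exact natDegree_eq_of_degree_eq (degree_eq_degree_of_associated (associated_of_dvd_dvd h1 h2))

theorem Equivalent.refl (α : LaurentSeries K) : Equivalent α α :=
  ⟨1, by simp, by simp⟩

end Equivalence

/-! ### Stepanov's method: infinitely many square values of `D`. -/

section CurvePoints

variable {K : Type*} [Field K]

/-- The decomposition of a polynomial along the basis `1, T, …, T ^ (r - 1)` of `K[T]` over the
subring of `r`-th powers. -/
theorem exists_eq_sum_pow_mul_X_pow {p : ℕ} [Fact p.Prime] [CharP K p] {r μ : ℕ} (hr : r = p ^ μ)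
    (hroot : ∀ c : K, ∃ b : K, b ^ r = c) (P : K[X]) :
    ∃ u : ℕ → K[X], (∀ j, (u j).natDegree ≤ P.natDegree / r) ∧
      P = ∑ j ∈ Finset.range r, u j ^ r * X ^ j := by
  choose root hroot using hroot
  have hr0 : 0 < r := hr ▸ pow_pos (Fact.out : p.Prime).pos _
  refine ⟨fun j => ∑ k ∈ P.support with k % r = j, monomial (k / r) (root (P.coeff k)),
    fun j => ?_, ?_⟩
  · refine natDegree_sum_le_of_forall_le _ _ fun k hk => (natDegree_monomial_le _).trans ?_
    exact Nat.div_le_div_right (le_natDegree_of_mem_supp _ (Finset.mem_filter.1 hk).1)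
  · have h1 : ∀ j, (∑ k ∈ P.support with k % r = j, monomial (k / r) (root (P.coeff k))) ^ r * X ^ j
        = ∑ k ∈ P.support with k % r = j, monomial k (P.coeff k) := by
      intro j
      have h2 : ∀ (s : Finset ℕ) (f : ℕ → K[X]), (∑ i ∈ s, f i) ^ r = ∑ i ∈ s, f i ^ r := by
        intro s f
        rw [hr, sum_pow_char_pow]
      rw [h2, Finset.sum_mul]
      refine Finset.sum_congr rfl fun k hk => ?_
      rw [monomial_pow, hroot, monomial_mul_X_pow]
      rw [← (Finset.mem_filter.1 hk).2, mul_comm, Nat.div_add_mod]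
    simp only [h1]
    rw [Finset.sum_fiberwise_of_maps_to (fun k _ => Finset.mem_range.2 (Nat.mod_lt k hr0))]
    exact P.as_sum_support

/-- A sum `∑ u_j T ^ (N j)` with `u_j` of small degree differs from `D ^ ((N + 1) / 2)`, when
`D` is not a square. -/
theorem sum_add_pow_ne_zero {p : ℕ} [Fact p.Prime] [CharP K p] {N ν r d : ℕ} (hN : N = p ^ ν)
    (hodd : Odd N) {D : K[X]} (hdeg : D.natDegree = d + d) (hd : 0 < d) (hD : ¬ IsSquare D)
    (hlc : IsSquare D.leadingCoeff) (u : ℕ → K[X]) (hu : ∀ j, (u j).natDegree ≤ 2 * d)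
    (hNd : 4 * d < N) (hrd : d ≤ r) :
    ∑ j ∈ Finset.range r, u j * X ^ (N * j) + D ^ ((N + 1) / 2) ≠ 0 := by
  intro hF
  -- If the sum vanished, `low + T ^ (N d) g` would be `-D ^ ((N + 1) / 2)`, whose square is `D * D
  -- ^ N`. As `N` is a power of the characteristic, `D ^ N` is its leading term plus terms at least
  -- `N` degrees lower.
  set low := ∑ j ∈ Finset.range d, u j * X ^ (N * j) with hlow
  set g := ∑ j ∈ Finset.range (r - d), u (d + j) * X ^ (N * j) with hg
  have hsplit : ∑ j ∈ Finset.range r, u j * X ^ (N * j) = low + X ^ (N * d) * g := by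
    rw [← Finset.sum_range_add_sum_Ico _ hrd, Finset.sum_Ico_eq_sum_range, hlow, hg,
      Finset.mul_sum]
    congr 1
    refine Finset.sum_congr rfl fun j _ => ?_
    rw [mul_add, pow_add]
    ring
  obtain ⟨m, hm⟩ := hodd
  have hNd' : ∃ k, N * d = k + N := ⟨N * (d - 1), by
    obtain ⟨d, rfl⟩ := Nat.exists_eq_succ_of_ne_zero hd.ne'
    simp [Nat.mul_succ]⟩
  obtain ⟨k, hk⟩ := hNd'
  have hlowdeg : low.natDegree ≤ 2 * d + k := by
    refine natDegree_sum_le_of_forall_le _ _ fun j hj => ?_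
    refine natDegree_mul_le.trans ?_
    rw [natDegree_X_pow]
    have : N * (j + 1) ≤ N * d := Nat.mul_le_mul_left _ (Finset.mem_range.1 hj)
    have := hu j
    rw [Nat.mul_succ] at *
    omega
  have hW : low + X ^ (N * d) * g = - D ^ (m + 1) := by
    rw [hsplit, add_eq_zero_iff_eq_neg] at hF
    rw [hF]
    congr 2
    omega
  have hgdeg : g.natDegree ≤ 2 * d := by
    by_cases hg0 : g = 0
    · simp [hg0]
    have h1 : X ^ (N * d) * g = - D ^ (m + 1) - low := by rw [← hW]; ring
    have h2 : (X ^ (N * d) * g).natDegree ≤ N * d + 2 * d := by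
      rw [h1]
      refine (natDegree_sub_le _ _).trans (max_le ?_ (by omega))
      rw [natDegree_neg, natDegree_pow, hdeg, hm]
      have : (m + 1) * (d + d) = (2 * m + 1) * d + d := by ring
      omega
    rw [natDegree_X_pow_mul _ hg0] at h2
    omega
  have hDN : D ^ N = C (D.leadingCoeff ^ N) * X ^ (2 * (N * d)) + D.eraseLead ^ N := by
    nth_rewrite 1 [← D.eraseLead_add_C_mul_X_pow]
    nth_rewrite 1 [hN]
    rw [add_pow_char_pow, ← hN, mul_pow, ← map_pow, ← pow_mul, hdeg,
      show (d + d) * N = 2 * (N * d) by ring, add_comm]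
  have hrest : (D.eraseLead ^ N).natDegree ≤ k + N * d := by
    refine natDegree_pow_le.trans ?_
    have h1 := D.eraseLead_natDegree_le
    calc N * D.eraseLead.natDegree ≤ N * (d + d - 1) := Nat.mul_le_mul_left _ (by omega)
      _ ≤ k + N * d := by
        rw [Nat.mul_sub, mul_add]
        omega
  have key : X ^ (2 * (N * d)) * (C (D.leadingCoeff ^ N) * D - g ^ 2) =
      low * (low + 2 * X ^ (N * d) * g) - D * D.eraseLead ^ N := by
    have h1 : (low + X ^ (N * d) * g) ^ 2 = D * D ^ N := by
      rw [hW, hm]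
      ring
    rw [hDN] at h1
    rw [two_mul (N * d), pow_add] at h1 ⊢
    linear_combination -h1
  -- The right side of `key` has degree at most `2 N d - N + 4 d < 2 N d`, so the factor of `T ^ (2
  -- N d)` vanishes and `D` is a square up to the square constant.
  have hzero : C (D.leadingCoeff ^ N) * D - g ^ 2 = 0 := by
    by_contra h0
    have h1 := congrArg natDegree key
    rw [natDegree_X_pow_mul _ h0] at h1
    have h2 : (low * (low + 2 * X ^ (N * d) * g) - D * D.eraseLead ^ N).natDegree ≤
        4 * d + k + N * d := by
      refine (natDegree_sub_le _ _).trans (max_le ?_ ?_)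
      · refine natDegree_mul_le.trans ?_
        have : (low + 2 * X ^ (N * d) * g).natDegree ≤ N * d + 2 * d := by
          refine (natDegree_add_le _ _).trans (max_le (by omega) ?_)
          rw [mul_assoc, ← C_ofNat]
          refine (natDegree_C_mul_le _ _).trans (natDegree_mul_le.trans ?_)
          rw [natDegree_X_pow]
          omega
        omega
      · refine natDegree_mul_le.trans ?_
        omega
    omega
  have hD0 : D ≠ 0 := by
    rintro rfl
    simp at hdeg
    omega
  obtain ⟨c, hc⟩ := hlc
  have hc0 : c ≠ 0 := by
    rintro rfl
    simp [hD0] at hc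
  refine hD (isSquare_of_mul_sq_eq_sq (a := g) (b := C (c ^ N)) (by simp [hc0]) ?_)
  rw [sub_eq_zero] at hzero
  rw [← hzero, hc, mul_comm, ← map_pow]
  congr 2
  ring

/-- A Stepanov-type auxiliary polynomial. -/
theorem exists_auxiliary_polynomial {p : ℕ} [Fact p.Prime] [CharP K p] {N ν r μ d : ℕ}
    (hN : N = p ^ ν) (hr : r = p ^ μ) (hp : p ≠ 2) (hroot : ∀ c : K, ∃ b : K, b ^ r = c)
    {D : K[X]} (hdeg : D.natDegree = d + d) (hd : 0 < d) (hD : ¬ IsSquare D)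
    (hlc : IsSquare D.leadingCoeff) (hNd : 4 * d < N) (hrd : d < r) :
    ∃ F : K[X], F ≠ 0 ∧ F.natDegree + N ≤ r * N + 2 * d ∧
      ∀ θ : K, θ ^ (r * N) = θ → D.eval θ ^ (r * N / 2) = -1 → F.eval θ = 0 := by
  have hpo : Odd p := (Fact.out : p.Prime).odd_of_ne_two hp
  have hNo : Odd N := hN ▸ hpo.pow
  have hro : Odd r := hr ▸ hpo.pow
  obtain ⟨u, hu, hsum⟩ := exists_eq_sum_pow_mul_X_pow hr hroot (D ^ ((r + 1) / 2))
  obtain ⟨m, hm⟩ := id hNo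
  obtain ⟨k, hk⟩ := id hro
  have hu' : ∀ j, (u j).natDegree ≤ 2 * d := by
    intro j
    refine (hu j).trans ?_
    rw [natDegree_pow, hdeg, show (r + 1) / 2 = k + 1 by omega]
    apply Nat.div_le_of_le_mul
    rw [hk]
    nlinarith
  refine ⟨_, sum_add_pow_ne_zero hN hNo hdeg hd hD hlc u hu' hNd hrd.le, ?_, ?_⟩
  · have hrN : d * N + N ≤ r * N := by
      rw [← Nat.succ_mul]
      exact Nat.mul_le_mul_right _ hrd
    rw [← Nat.le_sub_iff_add_le (by nlinarith)]
    refine (natDegree_add_le _ _).trans (max_le ?_ ?_)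
    · refine natDegree_sum_le_of_forall_le _ _ fun j hj => ?_
      refine natDegree_mul_le.trans ?_
      rw [natDegree_X_pow]
      have h1 : N * j + N ≤ r * N := by
        rw [← Nat.mul_succ, mul_comm]
        exact Nat.mul_le_mul_right _ (Finset.mem_range.1 hj)
      have := hu' j
      omega
    · rw [natDegree_pow, hdeg, show (N + 1) / 2 = m + 1 by omega]
      have : (m + 1) * (d + d) = d * N + d := by rw [hm]; ring
      omega
  · intro θ hθ hDθ
    have hr0 : r ≠ 0 := by omega
    -- The `r`-th power of the value is computed instead: since `θ ^ (r N) = θ`, the sum becomes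
    -- `D(θ) ^ ((r + 1) / 2)`, and the second term becomes its negative because `r (N + 1) / 2 = (r
    -- N - 1) / 2 + (r + 1) / 2`.
    apply pow_eq_zero_iff hr0 |>.1
    have h1 := congrArg (eval θ) hsum
    simp only [eval_pow, eval_finsetSum, eval_mul, eval_X] at h1
    simp only [eval_add, eval_pow, eval_finsetSum, eval_mul, eval_X]
    have h2 : (∑ j ∈ Finset.range r, eval θ (u j) * θ ^ (N * j)) ^ r =
        ∑ j ∈ Finset.range r, eval θ (u j) ^ r * θ ^ j := by
      nth_rewrite 2 [hr]
      rw [sum_pow_char_pow, ← hr]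
      refine Finset.sum_congr rfl fun j _ => ?_
      rw [mul_pow, ← pow_mul, show N * j * r = r * N * j by ring, pow_mul, hθ]
    have h3 : (eval θ D ^ ((N + 1) / 2)) ^ r = - eval θ D ^ ((r + 1) / 2) := by
      have e1 : r * N / 2 = (m * r + k) := by
        rw [hm, show r * (2 * m + 1) = 2 * (m * r) + r by ring]
        omega
      rw [← pow_mul, show (N + 1) / 2 * r = r * N / 2 + (r + 1) / 2 by
        rw [e1, show (N + 1) / 2 = m + 1 by omega, add_mul]
        omega, pow_add, hDθ]
      ring
    have h4 : ∀ a b : K, (a + b) ^ r = a ^ r + b ^ r := by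
      intro a b
      rw [hr, add_pow_char_pow]
    rw [h4, h2, h3, ← h1]
    ring

theorem exists_finite_intermediateField (F : Type*) [Field F] [Finite F] [Algebra F K]
    [Algebra.IsAlgebraic F K] {t : Set K} (ht : t.Finite) :
    ∃ k : IntermediateField F K, Finite k ∧ t ⊆ k := by
  have : Finite t := ht
  have := IntermediateField.finiteDimensional_adjoin (K := F) (S := t)
    (fun x _ => Algebra.IsIntegral.isIntegral x)
  exact ⟨IntermediateField.adjoin F t, Module.finite_of_finite F,
    IntermediateField.subset_adjoin F t⟩

/-- Otherwise, in a large finite subfield of `Q` elements, all but boundedly many `θ` satisfy `D(θ)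
^ ((Q - 1) / 2) = -1`. They are then roots of an auxiliary polynomial of degree at most `Q - N + 2
d`, too many once `N = Q / r` is large. -/
theorem infinite_isSquare_eval (F : Type*) [Field F] [Finite F] [Algebra F K]
    [Algebra.IsAlgebraic F K] [Infinite K] (hK : ringChar K ≠ 2) {D : K[X]}
    (hD : D ∈ admissible K) : {θ : K | IsSquare (D.eval θ)}.Infinite := by
  intro hfin
  obtain ⟨⟨d, hd⟩, hns, hlc⟩ := hD
  obtain ⟨p, hpF⟩ := CharP.exists F
  classical
  have hp : Fact p.Prime := ⟨CharP.char_is_prime F p⟩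
  have hpK : CharP K p := charP_of_injective_algebraMap (algebraMap F K).injective p
  have hp2 : p ≠ 2 := by rwa [ringChar.eq K p] at hK
  have hd0 : 0 < d := by
    rcases Nat.eq_zero_or_pos d with rfl | h
    · exfalso
      obtain ⟨c, hc⟩ := hlc
      apply hns
      rw [eq_C_of_natDegree_eq_zero hd]
      refine ⟨C c, ?_⟩
      rw [← map_mul, ← hc, leadingCoeff, hd]
    · exact h
  have hperf : PerfectField K := Algebra.IsAlgebraic.perfectField (K := F)
  have hpr : PerfectRing K p := PerfectField.toPerfectRing p
  set μ := d with hμ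
  set r := p ^ μ with hr
  have hrd : d < r := Nat.lt_pow_self hp.out.one_lt
  have hroot : ∀ c : K, ∃ b : K, b ^ r = c := by
    intro c
    obtain ⟨b, hb⟩ := (iterateFrobeniusEquiv K p μ).surjective c
    exact ⟨b, by rw [← hb, iterateFrobeniusEquiv_apply, iterateFrobenius_def]⟩
  -- With `Q ≥ B`, the quotient `N = Q / r` exceeds `4 d` and outweighs `2 d` plus the number of
  -- exceptions.
  set B := r * (4 * d + 1 + hfin.toFinset.card) with hB
  obtain ⟨t, ht⟩ := Infinite.exists_subset_card_eq K B
  obtain ⟨k, hkfin, hk⟩ := exists_finite_intermediateField (K := K) F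
    ((t.finite_toSet).union (D.support.image D.coeff).finite_toSet)
  have := Fintype.ofFinite k
  have hpk : CharP k p := charP_of_injective_algebraMap (algebraMap F k).injective p
  obtain ⟨f, -, hf⟩ := FiniteField.card k p
  set Q := Fintype.card k with hQ
  have hBQ : B ≤ Q := by
    rw [← ht, ← Fintype.card_coe, hQ]
    exact Fintype.card_le_of_injective (fun x => (⟨x.1, hk (Or.inl x.2)⟩ : k))
      (fun x y h => Subtype.ext (congrArg (fun z : k => (z : K)) h))
  have hrQ : r ∣ Q := by
    rw [hf, hr]
    apply pow_dvd_pow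
    by_contra h
    have h1 : Q < r := by
      rw [hf, hr]
      exact Nat.pow_lt_pow_right hp.out.one_lt (not_le.1 h)
    have : r * 1 ≤ B := Nat.mul_le_mul_left _ (by omega)
    omega
  obtain ⟨N, hQN⟩ := hrQ
  have hNp : ∃ ν, N = p ^ ν := by
    obtain ⟨ν, -, h⟩ := (Nat.dvd_prime_pow hp.out).1 (Dvd.intro_left r (hQN.symm.trans hf))
    exact ⟨ν, h⟩
  obtain ⟨ν, hν⟩ := hNp
  have hNB : 4 * d + 1 + hfin.toFinset.card ≤ N := by
    rw [hB, hQN] at hBQ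
    exact Nat.le_of_mul_le_mul_left hBQ (by omega)
  obtain ⟨G, hG0, hGdeg, hG⟩ := exists_auxiliary_polynomial hν hr hp2 hroot hd hd0 hns hlc
    (by omega) hrd
  have hDk : ∀ θ : k, D.eval (θ : K) ∈ k := by
    intro θ
    rw [eval_eq_sum]
    refine sum_mem fun i hi => mul_mem (hk (Or.inr ?_)) (pow_mem θ.2 i)
    exact Finset.mem_coe.2 (Finset.mem_image_of_mem _ hi)
  have hk2 : ringChar k ≠ 2 := by rwa [ringChar.eq k p]
  set Z := (Finset.univ.image (fun θ : k => (θ : K))) \ hfin.toFinset with hZ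
  have hZroot : Z.val ⊆ G.roots := by
    intro θ hθ
    have hθ : θ ∈ Z := hθ
    simp only [hZ, Finset.mem_sdiff, Finset.mem_image, Finset.mem_univ, true_and,
      Set.Finite.mem_toFinset, Set.mem_ofPred_eq] at hθ
    obtain ⟨⟨θ, rfl⟩, hsq⟩ := hθ
    rw [mem_roots hG0]
    have h1 : ∀ z : k, (z : K) ^ Q = z := by
      intro z
      exact_mod_cast congrArg (fun w : k => (w : K)) (FiniteField.pow_card z)
    refine hG _ (by rw [← hQN, h1]) ?_
    set w : k := ⟨D.eval (θ : K), hDk θ⟩ with hw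
    have hw0 : w ≠ 0 := by
      intro h
      apply hsq
      have : D.eval (θ : K) = 0 := congrArg (fun w : k => (w : K)) h
      rw [this]
      exact ⟨0, by simp⟩
    have hw1 : w ^ (Q / 2) = -1 := by
      refine (FiniteField.pow_dichotomy hk2 hw0).resolve_left fun h => hsq ?_
      obtain ⟨v, hv⟩ := (FiniteField.isSquare_iff hk2 hw0).2 h
      exact ⟨v, congrArg (fun w : k => (w : K)) hv⟩
    rw [← hQN]
    exact congrArg (fun w : k => (w : K)) hw1
  have hcard := card_le_degree_of_subset_roots hZroot
  have hZcard : Q - hfin.toFinset.card ≤ Z.card := by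
    have := Finset.le_card_sdiff hfin.toFinset (Finset.univ.image (fun θ : k => (θ : K)))
    rwa [Finset.card_image_of_injective _ Subtype.val_injective, Finset.card_univ] at this
  omega

end CurvePoints

/-! ### Pell's equation over finite fields and their algebraic extensions. -/

section Pell

variable {K : Type*} [Field K]

theorem exists_natDegree_eq_add_self {D : K[X]} (hD : D ∈ admissible K) :
    ∃ d : ℕ, 0 < d ∧ D.natDegree = d + d := by
  obtain ⟨⟨d, hd⟩, hns, ⟨c, hc⟩⟩ := hD
  refine ⟨d, Nat.pos_of_ne_zero ?_, hd⟩
  rintro rfl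
  apply hns
  rw [eq_C_of_natDegree_eq_zero hd]
  refine ⟨C c, ?_⟩
  rw [← map_mul, ← hc, leadingCoeff, hd]

theorem order_sqrt {D : K[X]} (hD : ¬ IsSquare D) {s : LaurentSeries K} (hs : s ^ 2 = ofPoly D)
    {d : ℕ} (hd : D.natDegree = d + d) : s ≠ 0 ∧ s.order = -(d : ℤ) := by
  have hD0 : D ≠ 0 := by
    rintro rfl
    exact hD ⟨0, by simp⟩
  have hs0 : s ≠ 0 := by
    rintro rfl
    exact ofPoly_ne_zero hD0 (by rw [← hs]; simp)
  have := congrArg HahnSeries.order hs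
  rw [HahnSeries.order_pow, order_ofPoly hD0, hd] at this
  rw [nsmul_eq_mul] at this
  push_cast at this
  exact ⟨hs0, by omega⟩

theorem coeff_ofPoly_C_mul (c : K) (p : K[X]) (z : LaurentSeries K) (j : ℤ) :
    (ofPoly (C c * p) * z).coeff j = c * (ofPoly p * z).coeff j := by
  rw [map_mul, mul_assoc, ← monomial_zero_left, ofPoly_monomial]
  simp

/-- Dirichlet's approximation theorem. -/
theorem exists_monic_approx (s : LaurentSeries K) (n : ℕ) :
    ∃ p q : K[X], q.Monic ∧ q.natDegree ≤ n ∧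
      (ofPoly q * s - ofPoly p ≠ 0 → (n + 1 : ℤ) ≤ (ofPoly q * s - ofPoly p).order) := by
  let Φ : degreeLT K (n + 1) →ₗ[K] (Fin n → K) :=
    { toFun := fun q j => (ofPoly q.1 * s).coeff (j.1 + 1 : ℤ)
      map_add' := by
        intro q q'
        ext j
        simp [add_mul]
      map_smul' := by
        intro c q
        ext j
        simp only [Submodule.coe_smul, smul_eq_C_mul, coeff_ofPoly_C_mul]
        rfl }
  have hfd : FiniteDimensional K (degreeLT K (n + 1)) :=
    Module.Finite.equiv (degreeLTEquiv K (n + 1)).symm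
  -- The `n + 1` coefficients of `q` face only `n` linear conditions.
  have hker : Φ.ker ≠ ⊥ := by
    apply LinearMap.ker_ne_bot_of_finrank_lt
    rw [(degreeLTEquiv K (n + 1)).finrank_eq]
    simp
  obtain ⟨⟨q, hq⟩, hΦ, hq0⟩ := Submodule.exists_mem_ne_zero_of_ne_bot hker
  have hq0' : q ≠ 0 := fun h => hq0 (Subtype.ext h)
  have hΦ' : ∀ j : Fin n, (ofPoly q * s).coeff (j.1 + 1 : ℤ) = 0 := fun j =>
    congrFun (LinearMap.mem_ker.1 hΦ) j
  refine ⟨polyPart (ofPoly (C q.leadingCoeff⁻¹ * q) * s), C q.leadingCoeff⁻¹ * q, ?_, ?_, ?_⟩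
  · rw [mul_comm]
    exact monic_mul_leadingCoeff_inv hq0'
  · refine (natDegree_C_mul_le _ _).trans ?_
    have := (natDegree_lt_iff_degree_lt hq0').2 (mem_degreeLT.1 hq)
    omega
  · intro hne
    refine le_order_of_coeff hne fun j hj => ?_
    rcases le_or_gt j 0 with h | h
    · exact coeff_sub_polyPart_nonpos _ h
    · rw [coeff_sub_polyPart_pos _ h, coeff_ofPoly_C_mul]
      have := hΦ' ⟨(j - 1).toNat, by omega⟩
      rw [show (((j - 1).toNat : ℕ) : ℤ) + 1 = j by omega] at this
      rw [this, mul_zero]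

/-- Dirichlet approximations to `√D` give infinitely many pairs of norm of degree below `d`. Two of
them share their norm `N` and their residues modulo `N`, and their quotient is a unit. -/
theorem exists_pell_of_finite [Finite K] (hK : ringChar K ≠ 2) {D : K[X]}
    (hD : D ∈ admissible K) : ∃ x y : K[X], x ^ 2 - D * y ^ 2 = 1 ∧ y ≠ 0 := by
  obtain ⟨s, hs⟩ := exists_sq_eq_ofPoly (Ring.two_ne_zero hK) hD
  obtain ⟨d, hd0, hd⟩ := exists_natDegree_eq_add_self hD
  have hns := hD.2.1
  obtain ⟨hs0, hso⟩ := order_sqrt hns hs hd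
  have h2 : (ofPoly (2 : K[X])) ≠ 0 := by
    rw [← C_ofNat]
    exact ofPoly_ne_zero (C_ne_zero.2 (Ring.two_ne_zero hK))
  have h2o : (ofPoly (2 : K[X])).order = 0 := by
    rw [← C_ofNat, order_ofPoly (C_ne_zero.2 (Ring.two_ne_zero hK))]
    simp
  set nm : K[X] × K[X] → K[X] := fun a => a.1 ^ 2 - D * a.2 ^ 2 with hnm
  have hnm0 : ∀ a : K[X] × K[X], a.2 ≠ 0 → nm a ≠ 0 := by
    intro a ha h
    exact hns (isSquare_of_mul_sq_eq_sq ha (sub_eq_zero.1 h).symm)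
  have hL0 : ∀ a : K[X] × K[X], a.2 ≠ 0 → ofPoly a.2 * s - ofPoly a.1 ≠ 0 := by
    intro a ha h
    refine ha (eq_zero_of_add_mul_sqrt_eq_zero hns hs (a := -a.1) (b := a.2) ?_).2
    rw [map_neg, ← h]
    ring
  set A : Set (K[X] × K[X]) := {a | a.2.Monic ∧ (nm a).natDegree < d} with hA
  have hAinf : A.Infinite := by
    refine Set.Infinite.of_image (fun a => (ofPoly a.2 * s - ofPoly a.1).order)
      (Set.infinite_of_forall_exists_gt fun m => ?_)
    obtain ⟨p, q, hq, hqn, ho⟩ := exists_monic_approx s m.toNat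
    have hL := hL0 (p, q) hq.ne_zero
    have ho' := ho hL
    refine ⟨_, ⟨(p, q), ⟨hq, ?_⟩, rfl⟩, by dsimp only; omega⟩
    set L := ofPoly q * s - ofPoly p with hLdef
    have hq0 := ofPoly_ne_zero hq.ne_zero
    have e1 : (ofPoly 2 * (ofPoly q * s)).order = -(q.natDegree : ℤ) - d := by
      rw [HahnSeries.order_mul h2 (mul_ne_zero hq0 hs0), HahnSeries.order_mul hq0 hs0, h2o,
        order_ofPoly hq.ne_zero, hso]
      ring
    obtain ⟨e2, e3⟩ := order_add_eq_right (a := -L) (b := ofPoly 2 * (ofPoly q * s))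
      (mul_ne_zero h2 (mul_ne_zero hq0 hs0)) (fun _ => by
        rw [HahnSeries.order_neg]
        omega)
    have e4 : ofPoly (nm (p, q)) = -L * (-L + ofPoly 2 * (ofPoly q * s)) := by
      simp only [hnm, map_sub, map_mul, map_pow, map_ofNat, hLdef]
      linear_combination ofPoly q ^ 2 * hs
    have e5 := congrArg HahnSeries.order e4
    rw [HahnSeries.order_mul (neg_ne_zero.2 hL) e2, HahnSeries.order_neg, e3, e1,
      order_ofPoly (hnm0 _ hq.ne_zero)] at e5
    omega
  have hfin : {P : K[X] | P.natDegree < d}.Finite := by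
    have hfd : FiniteDimensional K (degreeLT K d) :=
      Module.Finite.equiv (degreeLTEquiv K d).symm
    have : Finite (degreeLT K d) := Module.finite_of_finite K
    refine (Set.toFinite (degreeLT K d : Set K[X])).subset fun P hP => ?_
    refine mem_degreeLT.2 (lt_of_le_of_lt degree_le_natDegree ?_)
    exact_mod_cast hP
  obtain ⟨a, ha, b, hb, hab, heq⟩ := hAinf.exists_ne_map_eq_of_mapsTo
    (f := fun a => (nm a, a.1 % nm a, a.2 % nm a))
    (t := {P : K[X] | P.natDegree < d} ×ˢ {P : K[X] | P.natDegree < d} ×ˢ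
      {P : K[X] | P.natDegree < d}) (by
      rintro a ⟨ha1, ha2⟩
      have := hnm0 a ha1.ne_zero
      refine ⟨ha2, lt_of_le_of_lt ?_ ha2, lt_of_le_of_lt ?_ ha2⟩ <;>
      exact natDegree_le_natDegree (degree_mod_lt _ this).le) (hfin.prod (hfin.prod hfin))
  simp only [Prod.mk.injEq] at heq
  obtain ⟨hN, hm1, hm2⟩ := heq
  rw [← hN] at hm1 hm2
  set N := nm a with hNa
  have hN0 : N ≠ 0 := hnm0 a ha.1.ne_zero
  obtain ⟨u, hu⟩ : N ∣ a.1 - b.1 := EuclideanDomain.mod_eq_zero.1 (by rw [sub_mod, hm1, sub_self])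
  obtain ⟨v, hv⟩ : N ∣ a.2 - b.2 := EuclideanDomain.mod_eq_zero.1 (by rw [sub_mod, hm2, sub_self])
  have hNa' : a.1 ^ 2 - D * a.2 ^ 2 = N := rfl
  have hNb' : b.1 ^ 2 - D * b.2 ^ 2 = N := hN.symm
  -- `x + y √D` is the quotient of `a` by `b`, rewritten through the congruences modulo `N` so as to
  -- be visibly integral.
  set x := 1 + u * b.1 - D * v * b.2 with hx
  set y := v * b.1 - u * b.2 with hy
  have hxN : N * x = a.1 * b.1 - D * (a.2 * b.2) := by
    rw [hx]
    linear_combination -b.1 * hu + D * b.2 * hv - hNb'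
  have hyN : N * y = a.2 * b.1 - a.1 * b.2 := by
    rw [hy]
    linear_combination -b.1 * hv + b.2 * hu
  have hpell : x ^ 2 - D * y ^ 2 = 1 := by
    apply mul_left_cancel₀ (pow_ne_zero 2 hN0)
    linear_combination (N * x + (a.1 * b.1 - D * (a.2 * b.2))) * hxN -
      D * (N * y + (a.2 * b.1 - a.1 * b.2)) * hyN + (b.1 ^ 2 - D * b.2 ^ 2) * hNa' + N * hNb'
  refine ⟨x, y, hpell, fun hy0 => hab ?_⟩
  rw [hy0, mul_zero] at hyN
  have hax : a.1 = x * b.1 := by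
    apply mul_left_cancel₀ hN0
    linear_combination -b.1 * hxN - a.1 * hNb' - D * b.2 * hyN
  have hax2 : a.2 = x * b.2 := by
    apply mul_left_cancel₀ hN0
    linear_combination -b.2 * hxN - a.2 * hNb' - b.1 * hyN
  have hx1 : x = 1 := by
    have h1 : x * x = 1 := by
      rw [hy0] at hpell
      linear_combination hpell
    rcases mul_self_eq_one_iff.1 h1 with h | h
    · exact h
    · exfalso
      -- Monic denominators exclude the trivial quotient `-1`.
      have h3 := ha.1.leadingCoeff
      rw [hax2, h, neg_one_mul, leadingCoeff_neg, hb.1.leadingCoeff] at h3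
      exact Ring.neg_one_ne_one_of_char_ne_two hK h3
  exact Prod.ext (by rw [hax, hx1, one_mul]) (by rw [hax2, hx1, one_mul])

theorem exists_pell (F : Type*) [Field F] [Finite F] [Algebra F K] [Algebra.IsAlgebraic F K]
    (hK : ringChar K ≠ 2) {D : K[X]} (hD : D ∈ admissible K) :
    ∃ x y : K[X], x ^ 2 - D * y ^ 2 = 1 ∧ y ≠ 0 := by
  classical
  obtain ⟨heven, hns, ⟨c, hc⟩⟩ := hD
  obtain ⟨k, hkfin, hk⟩ := exists_finite_intermediateField (K := K) F
    ((Set.finite_singleton c).union (D.support.image D.coeff).finite_toSet)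
  have hinj := (algebraMap k K).injective
  obtain ⟨E, rfl⟩ : ∃ E : k[X], E.map (algebraMap k K) = D := by
    refine (mem_lifts D).1 ((lifts_iff_coeff_lifts D).2 fun n => ?_)
    by_cases hn : n ∈ D.support
    · exact ⟨⟨D.coeff n, hk (Or.inr (Finset.mem_coe.2 (Finset.mem_image_of_mem _ hn)))⟩, rfl⟩
    · exact ⟨0, by simp [notMem_support_iff.1 hn]⟩
  have hk2 : ringChar k ≠ 2 := by
    obtain ⟨p, hp⟩ := CharP.exists k
    have := charP_of_injective_algebraMap hinj p
    rwa [ringChar.eq K p, ← ringChar.eq k p] at hK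
  have hE : E ∈ admissible k := by
    refine ⟨by rwa [natDegree_map] at heven, fun h => hns ?_, ⟨c, hk (Or.inl rfl)⟩, ?_⟩
    · exact h.map (mapRingHom (algebraMap k K))
    · apply hinj
      rw [leadingCoeff_map] at hc
      exact hc
  obtain ⟨x, y, hxy, hy⟩ := exists_pell_of_finite hk2 hE
  refine ⟨x.map (algebraMap k K), y.map (algebraMap k K), ?_, by rwa [Polynomial.map_ne_zero_iff hinj]⟩
  rw [← Polynomial.map_pow, ← Polynomial.map_pow, ← Polynomial.map_mul, ← Polynomial.map_sub, hxy,
    Polynomial.map_one]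

theorem exists_pell_large (h2 : (2 : K) ≠ 0) {D : K[X]} (hD0 : 0 < D.natDegree) {x y : K[X]}
    (hxy : x ^ 2 - D * y ^ 2 = 1) (hy : y ≠ 0) (B : ℕ) :
    ∃ x y : K[X], x ^ 2 - D * y ^ 2 = 1 ∧ y ≠ 0 ∧ B ≤ y.natDegree := by
  induction B with
  | zero => exact ⟨x, y, hxy, hy, Nat.zero_le _⟩
  | succ B ih =>
    obtain ⟨x, y, hxy, hy, hB⟩ := ih
    have hDne : D ≠ 0 := by
      rintro rfl
      simp at hD0
    have hxdeg : 0 < x.natDegree := by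
      have h1 : x ^ 2 = D * y ^ 2 + C 1 := by
        rw [C_1]
        linear_combination hxy
      have h3 := congrArg natDegree h1
      rw [natDegree_add_C, natDegree_mul hDne (pow_ne_zero 2 hy), natDegree_pow] at h3
      omega
    have hx : x ≠ 0 := by
      rintro rfl
      simp at hxdeg
    -- This is the square of the unit `x + y √D`.
    refine ⟨x ^ 2 + D * y ^ 2, C 2 * (x * y), ?_, ?_, ?_⟩
    · have : (C 2 : K[X]) = 2 := map_ofNat C 2
      rw [this]
      linear_combination (x ^ 2 - D * y ^ 2 + 1) * hxy
    · exact mul_ne_zero (C_ne_zero.2 h2) (mul_ne_zero hx hy)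
    · rw [natDegree_C_mul h2, natDegree_mul hx hy]
      omega

/-- One of the two conjugates of a nontrivial unit of norm one is large. -/
theorem exists_order_unit (h2 : (2 : K) ≠ 0) {D : K[X]} (hns : ¬ IsSquare D) {d : ℕ} (hd0 : 0 < d)
    (hd : D.natDegree = d + d) {s : LaurentSeries K} (hs : s ^ 2 = ofPoly D) {x y : K[X]}
    (hxy : x ^ 2 - D * y ^ 2 = 1) (hy : y ≠ 0) :
    ∃ z : K[X], x ^ 2 - D * z ^ 2 = 1 ∧ z ≠ 0 ∧ z.natDegree = y.natDegree ∧
      (ofPoly x + ofPoly z * s).order < -(z.natDegree : ℤ) := by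
  obtain ⟨hs0, hso⟩ := order_sqrt hns hs hd
  by_contra! H
  have h1 := H y hxy hy rfl
  have h3 := H (-y) (by rw [neg_sq, hxy]) (neg_ne_zero.2 hy) (natDegree_neg y)
  rw [natDegree_neg] at h3
  -- The two conjugates differ by `2 y √D`, of degree `deg y + d`, so they cannot both have degree
  -- at most `deg y`.
  have e : (ofPoly x + ofPoly y * s) + -(ofPoly x + ofPoly (-y) * s) = ofPoly (C 2 * y) * s := by
    have : ofPoly (C (2 : K)) = 2 := by rw [C_ofNat, map_ofNat]
    rw [map_mul, map_neg, this]
    ring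
  have hy2 : C (2 : K) * y ≠ 0 := mul_ne_zero (C_ne_zero.2 h2) hy
  have h4 := le_order_add (n := -(y.natDegree : ℤ))
    (by rw [e]; exact mul_ne_zero (ofPoly_ne_zero hy2) hs0) (fun _ => h1)
    (fun _ => by rw [HahnSeries.order_neg]; exact h3)
  rw [e, HahnSeries.order_mul (ofPoly_ne_zero hy2) hs0, order_ofPoly hy2, hso,
    natDegree_C_mul h2] at h4
  omega

end Pell

/-! ### Generic interpolation points and the construction of `α`. -/

section Points

variable {K : Type*} [Field K]

/-- Generic evaluations impose independent conditions on finitely many vector spaces. -/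
theorem exists_finset_forall_eq_zero {V ι : Type*} [AddCommGroup V] [Module K V] [Finite ι]
    (W : ι → Submodule K V) [∀ i, FiniteDimensional K (W i)] (φ : K → V →ₗ[K] K) {Θ : Set K}
    (hΘ : Θ.Infinite) (hφ : ∀ i, ∀ f ∈ W i, f ≠ 0 → {θ ∈ Θ | φ θ f = 0}.Finite) {n : ℕ}
    (hn : ∀ i, Module.finrank K (W i) ≤ n) :
    ∃ t : Finset K, (t : Set K) ⊆ Θ ∧ t.card = n ∧
      ∀ i, ∀ f ∈ W i, (∀ θ ∈ t, φ θ f = 0) → f = 0 := by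
  classical
  suffices H : ∀ m : ℕ, ∃ t : Finset K, (t : Set K) ⊆ Θ ∧ t.card = m ∧
      ∀ i, Module.finrank K (W i ⊓ ⨅ θ ∈ t, (φ θ).ker : Submodule K V) ≤ n - m by
    obtain ⟨t, htΘ, htn, ht⟩ := H n
    refine ⟨t, htΘ, htn, fun i f hf hft => ?_⟩
    have h0 := ht i
    rw [Nat.sub_self, Nat.le_zero] at h0
    have : FiniteDimensional K (W i ⊓ ⨅ θ ∈ t, (φ θ).ker : Submodule K V) :=
      Submodule.finiteDimensional_of_le inf_le_left
    rw [Submodule.finrank_eq_zero] at h0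
    have hmem : f ∈ (W i ⊓ ⨅ θ ∈ t, (φ θ).ker : Submodule K V) :=
      ⟨hf, by simpa [Submodule.mem_iInf] using hft⟩
    rw [h0] at hmem
    exact (Submodule.mem_bot K).1 hmem
  intro m
  induction m with
  | zero => exact ⟨∅, by simp, rfl, fun i =>
      (Submodule.finrank_mono inf_le_left).trans (hn i)⟩
  | succ m ih =>
    obtain ⟨t, htΘ, htm, ht⟩ := ih
    have hex : ∀ i, ∃ S : Set K, S.Finite ∧ ∀ θ ∈ Θ, θ ∉ S →
        Module.finrank K (W i ⊓ ⨅ η ∈ insert θ t, (φ η).ker : Submodule K V) ≤ n - (m + 1) := by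
      intro i
      have hfd : FiniteDimensional K (W i ⊓ ⨅ θ ∈ t, (φ θ).ker : Submodule K V) :=
        Submodule.finiteDimensional_of_le inf_le_left
      have hle : ∀ θ, (W i ⊓ ⨅ η ∈ insert θ t, (φ η).ker : Submodule K V) ≤
          W i ⊓ ⨅ θ ∈ t, (φ θ).ker := fun θ =>
        inf_le_inf_left _ (biInf_mono fun _ h => Finset.mem_insert_of_mem h)
      by_cases hbot : (W i ⊓ ⨅ θ ∈ t, (φ θ).ker : Submodule K V) = ⊥
      · refine ⟨∅, Set.finite_empty, fun θ _ _ => ?_⟩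
        have := hle θ
        rw [hbot, le_bot_iff] at this
        rw [this, finrank_bot]
        exact Nat.zero_le _
      · obtain ⟨f, hf, hf0⟩ := Submodule.exists_mem_ne_zero_of_ne_bot hbot
        -- Any point where one chosen nonzero element does not vanish lowers the dimension; finitely
        -- many spaces exclude only finitely many points.
        refine ⟨_, hφ i f hf.1 hf0, fun θ hθ hθf => ?_⟩
        have hlt : (W i ⊓ ⨅ η ∈ insert θ t, (φ η).ker : Submodule K V) <
            W i ⊓ ⨅ θ ∈ t, (φ θ).ker := by
          refine lt_of_le_of_ne (hle θ) fun heq => hθf ⟨hθ, ?_⟩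
          rw [← heq] at hf
          exact (Submodule.mem_iInf _).1 ((Submodule.mem_iInf _).1 hf.2 θ) (Finset.mem_insert_self θ t)
        have h1 := Submodule.finrank_lt_finrank_of_lt hlt
        have h2 := ht i
        omega
    choose S hS hSθ using hex
    obtain ⟨θ, hθ, hθS⟩ := (hΘ.sdiff ((Set.finite_iUnion hS).union t.finite_toSet)).nonempty
    simp only [Set.mem_union, Set.mem_iUnion, not_or, not_exists, Finset.mem_coe] at hθS
    refine ⟨insert θ t, ?_, ?_, fun i => hSθ i θ hθ (hθS.1 i)⟩
    · rw [Finset.coe_insert]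
      exact Set.insert_subset hθ htΘ
    · rw [Finset.card_insert_of_notMem hθS.2, htm]

theorem finrank_degreeLT_prod (a b : ℕ) :
    FiniteDimensional K ((degreeLT K a).prod (degreeLT K b)) ∧
      Module.finrank K ((degreeLT K a).prod (degreeLT K b)) = a + b := by
  have e : ((degreeLT K a).prod (degreeLT K b)) ≃ₗ[K] (Fin a → K) × (Fin b → K) :=
    (show ((degreeLT K a).prod (degreeLT K b)) ≃ₗ[K] degreeLT K a × degreeLT K b from
      { toFun := fun z => (⟨z.1.1, z.2.1⟩, ⟨z.1.2, z.2.2⟩)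
        invFun := fun z => ⟨(z.1.1, z.2.1), z.1.2, z.2.2⟩
        map_add' := fun _ _ => rfl
        map_smul' := fun _ _ => rfl
        left_inv := fun _ => rfl
        right_inv := fun _ => rfl }).trans
      ((degreeLTEquiv K a).prodCongr (degreeLTEquiv K b))
  refine ⟨Module.Finite.equiv e.symm, ?_⟩
  rw [e.finrank_eq, Module.finrank_prod]
  simp

/-- There are `n` values `θ` in `Θ` at which no function `v - w E` with `deg v + deg w < n - 1`
vanishes simultaneously, where `E = x + y √D`. -/
theorem exists_points {D : K[X]} (hns : ¬ IsSquare D) {x y : K[X]} (hy : y ≠ 0)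
    {Θ : Set K} (hΘ : Θ.Infinite) {σ : K → K} (hσ : ∀ θ ∈ Θ, σ θ ^ 2 = D.eval θ) (n : ℕ) :
    ∃ t : Finset K, (t : Set K) ⊆ Θ ∧ t.card = n ∧
      ∀ v w : K[X], v ≠ 0 → w ≠ 0 →
        (∀ θ ∈ t, v.eval θ = w.eval θ * (x.eval θ + y.eval θ * σ θ)) →
          n ≤ v.natDegree + w.natDegree + 1 := by
  -- A pair with `deg w = i` and `deg v + deg w + 1 < n` lies in the `i`-th of these `n` spaces,
  -- each of dimension `n`.
  let W : Fin n → Submodule K (K[X] × K[X]) := fun i =>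
    (degreeLT K (n - 1 - i)).prod (degreeLT K (i + 1))
  have hW : ∀ i, FiniteDimensional K (W i) := fun i => (finrank_degreeLT_prod _ _).1
  let φ : K → K[X] × K[X] →ₗ[K] K := fun θ =>
    leval θ ∘ₗ LinearMap.fst K K[X] K[X] -
      (x.eval θ + y.eval θ * σ θ) • (leval θ ∘ₗ LinearMap.snd K K[X] K[X])
  have hφ : ∀ θ f, φ θ f = f.1.eval θ - (x.eval θ + y.eval θ * σ θ) * f.2.eval θ := fun θ f => rfl
  have hfin : ∀ i, ∀ f ∈ W i, f ≠ 0 → {θ ∈ Θ | φ θ f = 0}.Finite := by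
    intro i f _ hf0
    -- The norm of `v - w ε` is a nonzero polynomial that vanishes wherever `v - w ε` does.
    set N := (f.1 - f.2 * x) ^ 2 - D * (f.2 * y) ^ 2 with hN
    have hN0 : N ≠ 0 := by
      intro h
      by_cases hf2 : f.2 = 0
      · rw [hN, hf2] at h
        apply hf0
        refine Prod.ext ?_ hf2
        simpa using h
      · exact hns (isSquare_of_mul_sq_eq_sq (mul_ne_zero hf2 hy) (sub_eq_zero.1 h).symm)
    classical
    refine (N.roots.toFinset.finite_toSet).subset fun θ hθ => ?_
    rw [Finset.mem_coe, Multiset.mem_toFinset, mem_roots hN0]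
    have h1 := hθ.2
    rw [hφ] at h1
    simp only [IsRoot, hN, eval_sub, eval_pow, eval_mul]
    rw [← hσ θ hθ.1]
    linear_combination (f.1.eval θ - (x.eval θ - y.eval θ * σ θ) * f.2.eval θ) * h1
  obtain ⟨t, htΘ, htn, ht⟩ := exists_finset_forall_eq_zero W φ hΘ hfin (n := n)
    (fun i => by
      rw [(finrank_degreeLT_prod _ _).2]
      omega)
  refine ⟨t, htΘ, htn, fun v w hv hw h => ?_⟩
  by_contra hlt
  have := ht ⟨w.natDegree, by omega⟩ (v, w) ⟨?_, ?_⟩ (fun θ hθ => ?_)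
  · exact hw (congrArg Prod.snd this)
  · exact mem_degreeLT.2 ((natDegree_lt_iff_degree_lt hv).1 (by dsimp only; omega))
  · exact mem_degreeLT.2 ((natDegree_lt_iff_degree_lt hw).1 (by dsimp only; omega))
  · rw [hφ, h θ hθ]
    ring

/-- The main construction. -/
theorem exists_badlyApproximable_hasConductor {D : K[X]} (hD : D ∈ admissible K)
    (hΘ : {θ : K | IsSquare (D.eval θ)}.Infinite) {s : LaurentSeries K} (hs : s ^ 2 = ofPoly D)
    {x y : K[X]} (hxy : x ^ 2 - D * y ^ 2 = 1) (hy : y ≠ 0)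
    (ho : (ofPoly x + ofPoly y * s).order < -(y.natDegree : ℤ)) :
    ∃ α : LaurentSeries K, α ∈ IntermediateField.adjoin K {laurentT K, s} ∧
      BadlyApproximable α ∧ HasConductor s α y := by
  classical
  have hns : ¬ IsSquare D := hD.2.1
  have hD0 : D ≠ 0 := by
    rintro rfl
    exact hns ⟨0, by simp⟩
  have hyD0 : y * D ≠ 0 := mul_ne_zero hy hD0
  -- Removing the zeros of `y D` makes `x - e`, whose value at `θ` is `-y(θ) σ(θ)`, coprime to `h`.
  set Θ : Set K := {θ : K | IsSquare (D.eval θ)} \ ((y * D).roots.toFinset : Set K) with hΘdef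
  have hΘinf : Θ.Infinite := hΘ.sdiff (Finset.finite_toSet _)
  have hex : ∀ θ : K, ∃ σ : K, θ ∈ Θ → σ ^ 2 = D.eval θ := by
    intro θ
    by_cases h : θ ∈ Θ
    · obtain ⟨σ, hσ⟩ := h.1
      exact ⟨σ, fun _ => by rw [hσ, sq]⟩
    · exact ⟨0, fun h' => absurd h' h⟩
  choose σ hσ using hex
  obtain ⟨n, hn⟩ : ∃ n : ℕ, (ofPoly x + ofPoly y * s).order = -(n + 1 : ℤ) :=
    ⟨(-(ofPoly x + ofPoly y * s).order - 1).toNat, by omega⟩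
  obtain ⟨t, htΘ, htn, ht⟩ := exists_points hns hy hΘinf hσ n
  set E : K → K := fun θ => x.eval θ + y.eval θ * σ θ with hE
  have hnodal : ∀ P : K[X], (∀ θ ∈ t, P.eval θ = 0) → Lagrange.nodal t id ∣ P := by
    intro P hP
    refine Finset.prod_dvd_of_coprime (fun a _ b _ hab => ?_) fun θ hθ => ?_
    · exact isCoprime_X_sub_C_of_isUnit_sub (sub_ne_zero.2 hab).isUnit
    · exact dvd_iff_isRoot.2 (hP θ hθ)
  set h := Lagrange.nodal t (id : K → K) with hh
  have h0 : h ≠ 0 := Lagrange.nodal_ne_zero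
  have hdeg : h.natDegree = n := by rw [hh, Lagrange.natDegree_nodal, htn]
  set e := Lagrange.interpolate t id E with he
  have hev : ∀ θ ∈ t, e.eval θ = E θ := fun θ hθ =>
    Lagrange.eval_interpolate_at_node E (Set.injOn_id _) hθ
  have hnorm : ∀ θ ∈ t, x.eval θ ^ 2 - σ θ ^ 2 * y.eval θ ^ 2 = 1 := by
    intro θ hθ
    have := congrArg (eval θ) hxy
    simp only [eval_sub, eval_mul, eval_pow, eval_one] at this
    rw [hσ θ (htΘ hθ), this]
  have hdvd : h ∣ (2 * x - e) * e - 1 := by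
    apply hnodal
    intro θ hθ
    simp only [eval_sub, eval_mul, eval_one, eval_ofNat, hev θ hθ, hE]
    linear_combination hnorm θ hθ
  have hN : NormalFraction e h := by
    intro v w hv hw hvw
    rw [hdeg]
    refine ht v w hv hw fun θ hθ => ?_
    obtain ⟨c, hc⟩ := hvw
    have h1 := congrArg (eval θ) hc
    have h3 : h.eval θ = 0 := Lagrange.eval_nodal_at_node (v := (id : K → K)) hθ
    simp only [eval_sub, eval_mul, hev θ hθ, h3, hE] at h1
    linear_combination -h1
  have hT : ∀ P : K[X], ofPoly P ∈ IntermediateField.adjoin K {laurentT K, s} := by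
    intro P
    exact IntermediateField.algebra_adjoin_le_adjoin K _ (by
      refine (Algebra.adjoin_mono (Set.singleton_subset_iff.2 (Set.mem_insert _ _))) ?_
      exact aeval_mem_adjoin_singleton K (laurentT K))
  have hsmem : s ∈ IntermediateField.adjoin K {laurentT K, s} :=
    IntermediateField.subset_adjoin K _ (Set.mem_insert_of_mem _ rfl)
  refine ⟨(ofPoly x + ofPoly y * s - ofPoly e) / ofPoly h, ?_, ?_, ?_⟩
  · exact div_mem (sub_mem (add_mem (hT x) (mul_mem (hT y) hsmem)) (hT e)) (hT h)
  · exact hN.badlyApproximable hns hs hxy hy h0 (by rw [hn, hdeg]) hdvd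
  · obtain ⟨b, hb⟩ := hdvd
    refine ⟨x - e, h, b, h0, ?_, ?_, ?_⟩
    · refine IsCoprime.prod_left fun θ hθ => ?_
      rw [(irreducible_X_sub_C _).coprime_iff_not_dvd, dvd_iff_isRoot, IsRoot, eval_sub, id,
        hev θ hθ]
      intro h1
      have h3 : y.eval θ * σ θ = 0 := by
        simp only [hE] at h1
        linear_combination -h1
      apply (htΘ hθ).2
      rw [Finset.mem_coe, Multiset.mem_toFinset, mem_roots hyD0, IsRoot, eval_mul,
        ← hσ θ (htΘ hθ), sq, ← mul_assoc, h3, zero_mul]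
    · rw [mul_div_cancel₀ _ (ofPoly_ne_zero h0), map_sub]
      ring
    · rw [← hb, hs, ← map_pow, ← map_pow, ← map_add, ← map_mul]
      congr 1
      linear_combination hxy

end Points

end PolyMcMullen

/-! ### Infinitely many classes, indexed by the degree of the conductor. -/

theorem mainTheorem5 {F : Type*} {K : Type*} [Field F] [Finite F] [Field K] [Algebra F K]
    [Algebra.IsAlgebraic F K] [Infinite K] (hK : ringChar K ≠ 2) :
    PolyMcMullen.McMullenConjecture K 1 := by
  open PolyMcMullen in
  intro D hD
  have h2 : (2 : K) ≠ 0 := Ring.two_ne_zero hK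
  refine ⟨exists_sq_eq_ofPoly h2 hD, fun s hs => ?_⟩
  have hns : ¬ IsSquare D := hD.2.1
  obtain ⟨d, hd0, hd⟩ := exists_natDegree_eq_add_self hD
  obtain ⟨x, y, hxy, hy⟩ := exists_pell F hK hD
  set I : Set ℕ := {n | ∃ (α : LaurentSeries K) (y : K[X]), y.natDegree = n ∧
    α ∈ IntermediateField.adjoin K {laurentT K, s} ∧ BadlyApproximable α ∧ HasConductor s α y}
    with hI
  have hIinf : I.Infinite := by
    refine Set.infinite_of_forall_exists_gt fun B => ?_
    obtain ⟨x, y, hxy, hy, hB⟩ := exists_pell_large h2 (by omega) hxy hy (B + 1)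
    obtain ⟨z, hxz, hz, hzy, ho⟩ := exists_order_unit h2 hns hd0 hd hs hxy hy
    obtain ⟨α, h1, h3, h4⟩ := exists_badlyApproximable_hasConductor hD
      (infinite_isSquare_eval F hK hD) hs hxz hz ho
    exact ⟨z.natDegree, ⟨α, z, rfl, h1, h3, h4⟩, by omega⟩
  choose! α y hdeg hmem hbad hcond using fun n (hn : n ∈ I) => hn
  have hinj : ∀ m ∈ I, ∀ n ∈ I, Equivalent (α m) (α n) → m = n := by
    intro m hm n hn h
    rw [← hdeg m hm, ← hdeg n hn]
    exact (hcond m hm).natDegree_eq hns hs (hcond n hn) h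
  refine ⟨α '' I, ?_, ?_, ?_⟩
  · refine hIinf.image fun m hm n hn h => hinj m hm n hn ?_
    rw [h]
    exact Equivalent.refl _
  · rintro _ ⟨m, hm, rfl⟩ _ ⟨n, hn, rfl⟩ hne h
    exact hne (by rw [hinj m hm n hn h])
  · rintro _ ⟨n, hn, rfl⟩
    exact ⟨⟨hmem n hn, (hbad n hn).notMem_adjoin⟩, (hbad n hn).maxDegree_le⟩
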